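/- **Proposition 3.2.** Let $\mathfrak g$ be a finite-dimensional simple complex Lie algebra with a short grading, that is, a $\mathbb Z$-grading (with $[\mathfrak g_j,\mathfrak g_k]\subset\mathfrak g_{j+k}$) whose nonzero parts are exactly those of degree $-1,0,1$, so that $\mathfrak g=\mathfrak g_{-1}\oplus\mathfrak g_0\oplus\mathfrak g_1$. Let $(V_+,V_-)=(\mathfrak g_1,\mathfrak g_{-1})$ be the corresponding Jordan pair, with the trilinear products $V_\pm\times V_\mp\times V_\pm\to V_\pm$, $\{x,y,z\}=\tfrac12[[x,y],z]$, and let $B(x,y)=\mathrm{Tr}\{x,y,\cdot\}$ for $x\in V_\pm$, $y\in V_\mp$ (the trace being taken on $V_\pm$). A *Cartan involution of $\mathfrak g$* is an antilinear map $\tilde\omega:\mathfrak g\to\mathfrak g$ with $\tilde\omega^2=\mathrm{Id}$ and $\tilde\omega[x,y]=[\tilde\omega x,\tilde\omega y]$ such that the Hermitian form $x\mapsto-\kappa(x,\tilde\omega(x))$, with $\kappa$ the Killing form of $\mathfrak g$, is positive definite. It is *grading-reversing* if $\tilde\omega(\mathfrak g_k)=\mathfrak g_{-k}$ for all $k$.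 A *Cartan involution of the Jordan pair* is a pair $\omega$ of antilinear maps $V_\pm\to V_\mp$ with $\omega^2=\mathrm{Id}$ and $\{\omega(x),\omega(y),\omega(z)\}=\omega\{x,y,z\}$ such that the Hermitian form $H(x)=B(x,\omega(x))$ is positive definite on $V_+$ and on $V_-$. Let $\sigma\in\mathrm{Aut}(\mathfrak g)$ be the automorphism equal to $\mathrm{Id}$ on $\mathfrak g_0$ and to $-\mathrm{Id}$ on $\mathfrak g_{-1}\oplus\mathfrak g_1$. Then for every grading-reversing Cartan involution $\tilde\omega$ of $\mathfrak g$, the restriction $\omega=(\sigma\circ\tilde\omega)|_{\mathfrak g_{-1}\oplus\mathfrak g_1}$ is a Cartan involution of the Jordan pair $(V_+,V_-)$, and the correspondence $\tilde\omega\mapsto\omega$ is a bijection from the set of grading-reversing Cartan involutions of $\mathfrak g$ onto the set of Cartan involutions of $(V_+,V_-)$. -/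

import Mathlib

open scoped ComplexOrder

/-! ### Jordan pairs and their Cartan involutions -/

/-- A complex (linear) Jordan pair `(V₊, V₋)`: two vector spaces with trilinear products
`{x, y, z}` on `V₊ × V₋ × V₊` and on `V₋ × V₊ × V₋`, symmetric in the outer variables and
satisfying `[D(x, y), D(u, v)] = D({x, y, u}, v) - D(u, {y, x, v})`,
where `D(x, y) = {x, y, ·}`. -/
structure JordanPair (Vp Vm : Type*) [AddCommGroup Vp] [Module ℂ Vp]
    [AddCommGroup Vm] [Module ℂ Vm] where
  /-- `triP x y z = {x, y, z}` for `x, z ∈ V₊`, `y ∈ V₋`. -/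
  triP : Vp →ₗ[ℂ] Vm →ₗ[ℂ] Vp →ₗ[ℂ] Vp
  /-- `triM x y z = {x, y, z}` for `x, z ∈ V₋`, `y ∈ V₊`. -/
  triM : Vm →ₗ[ℂ] Vp →ₗ[ℂ] Vm →ₗ[ℂ] Vm
  symmP : ∀ x y z, triP x y z = triP z y x
  symmM : ∀ x y z, triM x y z = triM z y x
  jordanP : ∀ x y u v z, triP x y (triP u v z) - triP u v (triP x y z) =
    triP (triP x y u) v z - triP u (triM y x v) z
  jordanM : ∀ x y u v z, triM x y (triM u v z) - triM u v (triM x y z) =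
    triM (triM x y u) v z - triM u (triP y x v) z

namespace JordanPair

variable {Vp Vm : Type*} [AddCommGroup Vp] [Module ℂ Vp] [AddCommGroup Vm] [Module ℂ Vm]

/-- The Killing pairing `B(x, y) = Tr {x, y, ·}` for `x ∈ V₊`, `y ∈ V₋`. -/
noncomputable def killingP (J : JordanPair Vp Vm) : Vp →ₗ[ℂ] Vm →ₗ[ℂ] ℂ :=
  J.triP.compr₂ (LinearMap.trace ℂ Vp)

/-- The Killing pairing `B(x, y) = Tr {x, y, ·}` for `x ∈ V₋`, `y ∈ V₊`. -/
noncomputable def killingM (J : JordanPair Vp Vm) : Vm →ₗ[ℂ] Vp →ₗ[ℂ] ℂ :=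
  J.triM.compr₂ (LinearMap.trace ℂ Vm)

/-- A Cartan involution of a Jordan pair: a pair `ω` of antilinear maps `V₊ → V₋`, `V₋ → V₊`
with `ω² = id` and `{ω x, ω y, ω z} = ω {x, y, z}`, such that `H(x) = B(x, ω x)` is positive
definite on `V₊` and on `V₋` (for a complex number `z`, `0 < z` says that `z` is real and
positive). -/
@[ext]
structure CartanInvolution (J : JordanPair Vp Vm) where
  /-- The component `V₊ → V₋`. -/
  mapP : Vp →ₛₗ[starRingEnd ℂ] Vm
  /-- The component `V₋ → V₊`. -/
  mapM : Vm →ₛₗ[starRingEnd ℂ] Vp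
  mapM_mapP : ∀ x, mapM (mapP x) = x
  mapP_mapM : ∀ x, mapP (mapM x) = x
  map_triP : ∀ x y z, J.triM (mapP x) (mapM y) (mapP z) = mapP (J.triP x y z)
  map_triM : ∀ x y z, J.triP (mapM x) (mapP y) (mapM z) = mapM (J.triM x y z)
  posP : ∀ x, x ≠ 0 → 0 < J.killingP x (mapP x)
  posM : ∀ x, x ≠ 0 → 0 < J.killingM x (mapM x)

end JordanPair

/-! ### Cartan involutions of complex Lie algebras -/

/-- A Cartan involution of a finite-dimensional complex semisimple Lie algebra `𝔤`:
an antilinear involutive automorphism `θ` of `𝔤` such that the Hermitian form `-κ(x, θ y)`,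
with `κ` the Killing form, is positive definite (so that the fixed points of `θ` are a compact
real form of `𝔤`). -/
@[ext]
structure LieCartanInvolution (𝔤 : Type*) [LieRing 𝔤] [LieAlgebra ℂ 𝔤] where
  /-- The underlying antilinear map. -/
  toMap : 𝔤 →ₛₗ[starRingEnd ℂ] 𝔤
  invol : ∀ x, toMap (toMap x) = x
  map_bracket : ∀ x y, toMap ⁅x, y⁆ = ⁅toMap x, toMap y⁆
  pos : ∀ x, x ≠ 0 → 0 < -killingForm ℂ 𝔤 x (toMap x)

/-! ### Short gradings -/

section ShortGrading

variable {𝔤 : Type*} [LieRing 𝔤] [LieAlgebra ℂ 𝔤]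

/-- `θ` reverses the grading: `θ(𝔤ₖ) = 𝔤₋ₖ` for all `k`. -/
def LieCartanInvolution.ReversesGrading (θ : LieCartanInvolution 𝔤) (𝒢 : ℤ → Submodule ℂ 𝔤) :
    Prop :=
  ∀ k : ℤ, (𝒢 k).map θ.toMap = 𝒢 (-k)

/-- A short grading `𝔤 = 𝔤₋₁ ⊕ 𝔤₀ ⊕ 𝔤₁`: exactly these three parts are nonzero. -/
def IsShortGrading (𝒢 : ℤ → Submodule ℂ 𝔤) : Prop :=
  ∀ k : ℤ, 𝒢 k ≠ ⊥ ↔ k = -1 ∨ k = 0 ∨ k = 1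

variable (𝒢 : ℤ → Submodule ℂ 𝔤) [GradedLieAlgebra 𝒢]

/-- The linear map equal to `(-1)ᵏ` on `𝔤ₖ`. -/
noncomputable def gradingSignLin : 𝔤 →ₗ[ℂ] 𝔤 :=
  DirectSum.toModule ℂ ℤ 𝔤 (fun k => ((k.negOnePow : ℤ) : ℂ) • (𝒢 k).subtype) ∘ₗ
    (DirectSum.decomposeLinearEquiv 𝒢).toLinearMap

theorem gradingSignLin_apply {k : ℤ} {x : 𝔤} (hx : x ∈ 𝒢 k) :
    gradingSignLin 𝒢 x = ((k.negOnePow : ℤ) : ℂ) • x := by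
  have h : DirectSum.decomposeLinearEquiv 𝒢 x =
      DirectSum.lof ℂ ℤ (fun i => 𝒢 i) k ⟨x, hx⟩ := DirectSum.decompose_of_mem 𝒢 hx
  rw [gradingSignLin, LinearMap.comp_apply, LinearEquiv.coe_coe, h, DirectSum.toModule_lof]
  rfl

theorem gradingSignLin_lie (x y : 𝔤) :
    gradingSignLin 𝒢 ⁅x, y⁆ = ⁅gradingSignLin 𝒢 x, gradingSignLin 𝒢 y⁆ := by
  induction x using DirectSum.Decomposition.inductionOn 𝒢 with
  | zero => simp
  | add a b ha hb => simp [ha, hb]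
  | @homogeneous i a =>
    induction y using DirectSum.Decomposition.inductionOn 𝒢 with
    | zero => simp
    | add c d hc hd => simp [hc, hd]
    | @homogeneous j c =>
      rw [gradingSignLin_apply 𝒢 (SetLike.GradedBracket.bracket_mem a.2 c.2),
        gradingSignLin_apply 𝒢 a.2, gradingSignLin_apply 𝒢 c.2, smul_lie, lie_smul, smul_smul,
        Int.negOnePow_add]
      push_cast
      rfl

theorem gradingSignLin_invol (x : 𝔤) : gradingSignLin 𝒢 (gradingSignLin 𝒢 x) = x := by
  induction x using DirectSum.Decomposition.inductionOn 𝒢 with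
  | zero => simp
  | add a b ha hb => simp [ha, hb]
  | @homogeneous i a =>
    rw [gradingSignLin_apply 𝒢 a.2, map_smul, gradingSignLin_apply 𝒢 a.2, smul_smul]
    norm_cast
    rw [Int.units_mul_self]
    simp

/-- The automorphism `σ` of the graded Lie algebra `𝔤` that is `(-1)ᵏ` on `𝔤ₖ`; for a short grading,
it is `id` on `𝔤₀` and `-id` on `𝔤₋₁ ⊕ 𝔤₁`. -/
noncomputable def gradingAut : 𝔤 ≃ₗ⁅ℂ⁆ 𝔤 where
  toLinearMap := gradingSignLin 𝒢
  map_lie' := fun {x y} => gradingSignLin_lie 𝒢 x y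
  invFun := gradingSignLin 𝒢
  left_inv := gradingSignLin_invol 𝒢
  right_inv := gradingSignLin_invol 𝒢

theorem gradingAut_zero {x : 𝔤} (hx : x ∈ 𝒢 0) : gradingAut 𝒢 x = x := by
  have h := gradingSignLin_apply 𝒢 hx
  simp only [Int.negOnePow_zero, Units.val_one, Int.cast_one, one_smul] at h
  exact h

theorem gradingAut_one {x : 𝔤} (hx : x ∈ 𝒢 1) : gradingAut 𝒢 x = -x := by
  have h := gradingSignLin_apply 𝒢 hx
  simp only [Int.negOnePow_neg, Int.negOnePow_one, Units.val_neg, Units.val_one, Int.cast_neg,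
    Int.cast_one, neg_smul, one_smul] at h
  exact h

theorem gradingAut_neg_one {x : 𝔤} (hx : x ∈ 𝒢 (-1)) : gradingAut 𝒢 x = -x := by
  have h := gradingSignLin_apply 𝒢 hx
  simp only [Int.negOnePow_neg, Int.negOnePow_one, Units.val_neg, Units.val_one, Int.cast_neg,
    Int.cast_one, neg_smul, one_smul] at h
  exact h

/-- The trilinear product `(x, y, z) ↦ ½ [[x, y], z]` on `𝔤ᵢ × 𝔤ⱼ × 𝔤ᵢ`, where `i + j = 0`. -/
noncomputable def gradedTriple (i j : ℤ) (hij : i + j = 0) :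
    𝒢 i →ₗ[ℂ] 𝒢 j →ₗ[ℂ] 𝒢 i →ₗ[ℂ] 𝒢 i :=
  LinearMap.mk₂ ℂ
    (fun x y => ((1 / 2 : ℂ) • LieAlgebra.ad ℂ 𝔤 ⁅(x : 𝔤), (y : 𝔤)⁆).restrict (fun z hz => by
      have h := SetLike.GradedBracket.bracket_mem
        (SetLike.GradedBracket.bracket_mem x.2 y.2) hz
      rw [hij, zero_add] at h
      exact (𝒢 i).smul_mem _ h))
    (fun x x' y => by ext z; simp)
    (fun c x y => by ext z; simp [smul_comm c])
    (fun x y y' => by ext z; simp)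
    (fun c x y => by ext z; simp [smul_comm c])

theorem gradedTriple_coe (i j : ℤ) (hij : i + j = 0) (x : 𝒢 i) (y : 𝒢 j) (z : 𝒢 i) :
    (gradedTriple 𝒢 i j hij x y z : 𝔤) = (1 / 2 : ℂ) • ⁅⁅(x : 𝔤), (y : 𝔤)⁆, (z : 𝔤)⁆ := rfl

theorem gradedTriple_symm (i j : ℤ) (hij : i + j = 0) (hi : 𝒢 (i + i) = ⊥)
    (x : 𝒢 i) (y : 𝒢 j) (z : 𝒢 i) :
    gradedTriple 𝒢 i j hij x y z = gradedTriple 𝒢 i j hij z y x := by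
  have h : ⁅(x : 𝔤), (z : 𝔤)⁆ = 0 := by
    have h := SetLike.GradedBracket.bracket_mem x.2 z.2
    rwa [hi, Submodule.mem_bot] at h
  have key : ⁅⁅(x : 𝔤), (y : 𝔤)⁆, (z : 𝔤)⁆ = ⁅⁅(z : 𝔤), (y : 𝔤)⁆, (x : 𝔤)⁆ := by
    rw [lie_lie (x : 𝔤) (y : 𝔤) (z : 𝔤), h, lie_zero, sub_zero,
      ← lie_skew ⁅(z : 𝔤), (y : 𝔤)⁆ (x : 𝔤), ← lie_skew (z : 𝔤) (y : 𝔤), lie_neg, neg_neg]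
  ext
  rw [gradedTriple_coe, gradedTriple_coe, key]

theorem gradedTriple_jordan (i j : ℤ) (hij : i + j = 0) (hji : j + i = 0)
    (x : 𝒢 i) (y : 𝒢 j) (u : 𝒢 i) (v : 𝒢 j) (z : 𝒢 i) :
    gradedTriple 𝒢 i j hij x y (gradedTriple 𝒢 i j hij u v z) -
        gradedTriple 𝒢 i j hij u v (gradedTriple 𝒢 i j hij x y z) =
      gradedTriple 𝒢 i j hij (gradedTriple 𝒢 i j hij x y u) v z -
        gradedTriple 𝒢 i j hij u (gradedTriple 𝒢 j i hji y x v) z := by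
  have key (D u v z : 𝔤) : ⁅D, ⁅⁅u, v⁆, z⁆⁆ - ⁅⁅u, v⁆, ⁅D, z⁆⁆ =
      ⁅⁅⁅D, u⁆, v⁆, z⁆ + ⁅⁅u, ⁅D, v⁆⁆, z⁆ := by
    rw [leibniz_lie D ⁅u, v⁆ z, leibniz_lie D u v, add_lie]
    abel
  have k := key ⁅(x : 𝔤), (y : 𝔤)⁆ u v z
  ext
  simp only [AddSubgroupClass.coe_sub, gradedTriple_coe, lie_smul, smul_lie]
  rw [← lie_skew (y : 𝔤) (x : 𝔤), neg_lie, lie_neg, neg_lie, smul_neg, smul_neg, sub_neg_eq_add,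
    ← smul_sub, ← smul_add, ← smul_sub, ← smul_add, k]

/-- The Jordan pair of a shortly graded Lie algebra: `V₊ = 𝔤₁`, `V₋ = 𝔤₋₁`,
`{x, y, z} = ½ [[x, y], z]`. -/
noncomputable def IsShortGrading.jordanPair {𝒢 : ℤ → Submodule ℂ 𝔤} [GradedLieAlgebra 𝒢]
    (h : IsShortGrading 𝒢) : JordanPair (𝒢 1) (𝒢 (-1)) where
  triP := gradedTriple 𝒢 1 (-1) (by norm_num)
  triM := gradedTriple 𝒢 (-1) 1 (by norm_num)
  symmP := gradedTriple_symm 𝒢 1 (-1) _ (by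
    by_contra hne
    have := (h (1 + 1)).1 hne
    omega)
  symmM := gradedTriple_symm 𝒢 (-1) 1 _ (by
    by_contra hne
    have := (h (-1 + -1)).1 hne
    omega)
  jordanP := gradedTriple_jordan 𝒢 1 (-1) _ _
  jordanM := gradedTriple_jordan 𝒢 (-1) 1 _ _

end ShortGrading

/-! On 𝔤₁ ⊕ 𝔤₋₁ the map σ∘θ is -θ. For x ∈ 𝔤₁, y ∈ 𝔤₋₁ one has κ(x, y) = 2B(x, y) + 2B(y, x)
(`killingForm_one_neg_one`), and a grading-reversing θ forces B(x, y) = B(y, x)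
(`killingP_eq_killingM`). Hence 4B(x, ωx) = -κ(x, θx), and ω inherits positivity from θ.

For the converse, simplicity gives two facts: 𝔤₀ is spanned by [𝔤₁, 𝔤₋₁] (`mem_span_lie`) and acts
faithfully on 𝔤₁ ⊕ 𝔤₋₁ (`eq_zero_of_lie_eq_zero`). The first makes θ determined by ω. Together they
show that conjugating the action of z ∈ 𝔤₀ by ω gives the action of exactly one element of 𝔤₀. This
conjugation, glued to -ω, is an antilinear involutive automorphism of 𝔤.

Positivity of the extension is the delicate point on 𝔤₀. The action of z on 𝔤±₁ has, for the form H,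
minus the action of the conjugate of z as adjoint, so the contributions of 𝔤±₁ to -κ are traces of
the form Tr(f f*), and by faithfulness their sum is positive definite. This sum is itself an
invariant form on 𝔤₀, and the same argument applied to it shows that the contribution of 𝔤₀ is
nonnegative. -/

/-! ### Positive definite sesquilinear forms and traces -/

section Trace

variable {V : Type*} [AddCommGroup V] [Module ℂ V]

/-- A positive definite sesquilinear form over `ℂ` is Hermitian. -/
theorem conj_apply_of_posDef (H : V →ₗ[ℂ] V →ₛₗ[starRingEnd ℂ] ℂ)
    (hpos : ∀ x, x ≠ 0 → 0 < H x x) (x y : V) : starRingEnd ℂ (H x y) = H y x := by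
  have him (x : V) : (H x x).im = 0 := by
    by_cases hx : x = 0
    · simp [hx]
    · exact ((Complex.pos_iff.1 (hpos x hx)).2).symm
  -- Reality at x + y makes the imaginary parts of `H x y` and `H y x` opposite; reality at x + iy
  -- makes their real parts equal.
  have h₁ := him (x + y)
  have h₂ := him (x + Complex.I • y)
  simp only [map_add, LinearMap.add_apply, map_smul, LinearMap.smul_apply, LinearMap.map_smulₛₗ,
    Complex.conj_I, smul_eq_mul, Complex.add_im, Complex.add_re, Complex.mul_im, Complex.mul_re,
    Complex.neg_re, Complex.neg_im, Complex.I_re, Complex.I_im, him x, him y] at h₁ h₂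
  apply Complex.ext
  · rw [Complex.conj_re]; linarith
  · rw [Complex.conj_im]; linarith

variable [FiniteDimensional ℂ V]

/-- If `f'` is adjoint to `f` for a positive definite sesquilinear form, then the trace of `f * f'` is
nonnegative, and positive if `f ≠ 0`. -/
theorem trace_mul_adjoint_nonneg_and_pos (H : V →ₗ[ℂ] V →ₛₗ[starRingEnd ℂ] ℂ)
    (hpos : ∀ x, x ≠ 0 → 0 < H x x) (f f' : Module.End ℂ V)
    (hadj : ∀ x y, H (f x) y = H x (f' y)) :
    0 ≤ LinearMap.trace ℂ V (f * f') ∧ (f ≠ 0 → 0 < LinearMap.trace ℂ V (f * f')) := by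
  let c : InnerProductSpace.Core ℂ V :=
    -- The arguments are swapped because Mathlib's inner product is antilinear in the first
    -- variable.
    { inner := fun x y => H y x
      conj_inner_symm := fun x y => conj_apply_of_posDef H hpos x y
      re_inner_nonneg := fun x => by
        by_cases hx : x = 0
        · simp [hx]
        · exact (Complex.pos_iff.1 (hpos x hx)).1.le
      add_left := fun x y z => by simp
      smul_left := fun x y r => by simp
      definite := fun x hx => by
        by_contra h
        exact (hpos x h).ne' hx }
  let _ : NormedAddCommGroup V := c.toNormedAddCommGroup
  let _ : InnerProductSpace ℂ V := InnerProductSpace.ofCore c.toCore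
  let b := stdOrthonormalBasis ℂ V
  -- By cyclicity this is Tr(f' f), whose diagonal entries in an orthonormal basis are the squared
  -- norms of the `f (b i)`.
  have htr : LinearMap.trace ℂ V (f * f') = ∑ i, H (f (b i)) (f (b i)) := by
    rw [LinearMap.trace_mul_comm, LinearMap.trace_eq_sum_inner _ b]
    refine Finset.sum_congr rfl fun i _ => ?_
    rw [← conj_apply_of_posDef H hpos, hadj, conj_apply_of_posDef H hpos]
    rfl
  have hnn (x : V) : 0 ≤ H x x := by
    by_cases hx : x = 0
    · simp [hx]
    · exact (hpos x hx).le
  rw [htr]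
  refine ⟨Finset.sum_nonneg fun i _ => hnn _, fun hf => ?_⟩
  obtain ⟨i, hi⟩ : ∃ i, f (b i) ≠ 0 := by
    by_contra! h
    exact hf (b.toBasis.ext fun i => by simpa using h i)
  exact Finset.sum_pos' (fun i _ => hnn _) ⟨i, Finset.mem_univ i, hpos _ hi⟩

/-- Endomorphisms that are transposes of each other for a nondegenerate pairing have equal
traces. -/
theorem trace_eq_of_adjoint {W : Type*} [AddCommGroup W] [Module ℂ W] [FiniteDimensional ℂ W]
    (p : V →ₗ[ℂ] W →ₗ[ℂ] ℂ) (hV : ∀ x, x ≠ 0 → ∃ y, p x y ≠ 0) (hW : ∀ y, y ≠ 0 → ∃ x, p x y ≠ 0)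
    (f : Module.End ℂ V) (g : Module.End ℂ W) (h : ∀ x y, p (f x) y = p x (g y)) :
    LinearMap.trace ℂ V f = LinearMap.trace ℂ W g := by
  have hp : p.IsPerfPair := by
    refine LinearMap.IsPerfPair.of_injective ?_ ?_
    · rw [injective_iff_map_eq_zero]
      intro x hx
      by_contra hne
      obtain ⟨y, hy⟩ := hV x hne
      exact hy (by rw [hx]; rfl)
    · rw [injective_iff_map_eq_zero]
      intro y hy
      by_contra hne
      obtain ⟨x, hx⟩ := hW y hne
      exact hx (by rw [← LinearMap.flip_apply, hy]; rfl)
  -- The pairing identifies V with the dual of W and carries `f` to the transpose of `g`.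
  rw [← LinearMap.trace_transpose' g, ← LinearMap.trace_conj' f p.toPerfPair]
  congr 1
  ext φ y
  obtain ⟨x, rfl⟩ := p.toPerfPair.surjective φ
  simp [LinearEquiv.conj_apply, h, Module.Dual.transpose_apply]

end Trace

/-! ### Structure of short gradings -/

section Structure

variable {𝔤 : Type*} [LieRing 𝔤] [LieAlgebra ℂ 𝔤] {𝒢 : ℤ → Submodule ℂ 𝔤}

theorem IsShortGrading.eq_bot (h : IsShortGrading 𝒢) {k : ℤ} (h₁ : k ≠ -1) (h₂ : k ≠ 0)
    (h₃ : k ≠ 1) : 𝒢 k = ⊥ := by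
  by_contra hk
  rcases (h k).1 hk with h | h | h <;> contradiction

theorem IsShortGrading.cases_of_ne_zero (h : IsShortGrading 𝒢) {k : ℤ} {x : 𝔤} (hx : x ∈ 𝒢 k)
    (h0 : x ≠ 0) : k = -1 ∨ k = 0 ∨ k = 1 :=
  (h k).1 fun hb => h0 (by rwa [hb, Submodule.mem_bot] at hx)

variable [GradedLieAlgebra 𝒢]

theorem IsShortGrading.induction (h : IsShortGrading 𝒢) {motive : 𝔤 → Prop}
    (hm : ∀ x ∈ 𝒢 (-1), motive x) (hz : ∀ x ∈ 𝒢 0, motive x) (hp : ∀ x ∈ 𝒢 1, motive x)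
    (hadd : ∀ x y, motive x → motive y → motive (x + y)) (x : 𝔤) : motive x := by
  induction x using DirectSum.Decomposition.inductionOn 𝒢 with
  | zero => exact hz 0 (zero_mem _)
  | add a b ha hb => exact hadd _ _ ha hb
  | @homogeneous i a =>
    by_cases h0 : (a : 𝔤) = 0
    · rw [h0]; exact hz 0 (zero_mem _)
    · rcases h.cases_of_ne_zero a.2 h0 with rfl | rfl | rfl
      exacts [hm _ a.2, hz _ a.2, hp _ a.2]

theorem lie_mem_of_add_eq {i j k : ℤ} (hk : i + j = k) {x y : 𝔤} (hx : x ∈ 𝒢 i) (hy : y ∈ 𝒢 j) :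
    ⁅x, y⁆ ∈ 𝒢 k :=
  hk ▸ SetLike.GradedBracket.bracket_mem hx hy

theorem IsShortGrading.lie_eq_zero (h : IsShortGrading 𝒢) {i j : ℤ} (h₁ : i + j ≠ -1)
    (h₂ : i + j ≠ 0) (h₃ : i + j ≠ 1) {x y : 𝔤} (hx : x ∈ 𝒢 i) (hy : y ∈ 𝒢 j) : ⁅x, y⁆ = 0 := by
  have := lie_mem_of_add_eq rfl hx hy
  rwa [h.eq_bot h₁ h₂ h₃, Submodule.mem_bot] at this

variable (𝒢) in
/-- The projection onto a homogeneous part. -/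
noncomputable def gradedProj (k : ℤ) : 𝔤 →ₗ[ℂ] 𝒢 k :=
  DirectSum.component ℂ ℤ (fun i => 𝒢 i) k ∘ₗ (DirectSum.decomposeLinearEquiv 𝒢).toLinearMap

theorem gradedProj_of_mem {k : ℤ} {x : 𝔤} (hx : x ∈ 𝒢 k) : (gradedProj 𝒢 k x : 𝔤) = x :=
  DirectSum.decompose_of_mem_same 𝒢 hx

@[simp]
theorem gradedProj_coe {k : ℤ} (x : 𝒢 k) : gradedProj 𝒢 k x = x := by
  ext
  exact gradedProj_of_mem x.2

theorem gradedProj_of_ne {i k : ℤ} (hik : i ≠ k) {x : 𝔤} (hx : x ∈ 𝒢 i) :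
    gradedProj 𝒢 k x = 0 := by
  ext
  exact DirectSum.decompose_of_mem_ne 𝒢 hx hik

theorem IsShortGrading.eq_add (h : IsShortGrading 𝒢) (x : 𝔤) :
    x = gradedProj 𝒢 (-1) x + gradedProj 𝒢 0 x + gradedProj 𝒢 1 x := by
  induction x using h.induction with
  | hm x hx =>
    lift x to 𝒢 (-1) using hx
    simp [gradedProj_of_ne (show (-1 : ℤ) ≠ 0 by decide) x.2,
      gradedProj_of_ne (show (-1 : ℤ) ≠ 1 by decide) x.2]
  | hz x hx =>
    lift x to 𝒢 0 using hx
    simp [gradedProj_of_ne (show (0 : ℤ) ≠ -1 by decide) x.2,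
      gradedProj_of_ne (show (0 : ℤ) ≠ 1 by decide) x.2]
  | hp x hx =>
    lift x to 𝒢 1 using hx
    simp [gradedProj_of_ne (show (1 : ℤ) ≠ 0 by decide) x.2,
      gradedProj_of_ne (show (1 : ℤ) ≠ -1 by decide) x.2]
  | hadd x y hx hy =>
    simp only [map_add, Submodule.coe_add]
    nth_rw 1 [hx, hy]
    abel

theorem IsShortGrading.isInternal : DirectSum.IsInternal 𝒢 :=
  DirectSum.Decomposition.isInternal 𝒢

/-- In a simple Lie algebra with a short grading, `𝔤₀` is spanned by `[𝔤₁, 𝔤₋₁]`. -/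
theorem IsShortGrading.mem_span_lie [LieAlgebra.IsSimple ℂ 𝔤] (h : IsShortGrading 𝒢) {z : 𝔤}
    (hz : z ∈ 𝒢 0) :
    z ∈ Submodule.span ℂ {w : 𝔤 | ∃ x ∈ 𝒢 1, ∃ y ∈ 𝒢 (-1), ⁅x, y⁆ = w} := by
  set S := Submodule.span ℂ {w : 𝔤 | ∃ x ∈ 𝒢 1, ∃ y ∈ 𝒢 (-1), ⁅x, y⁆ = w} with hS
  have hS0 : S ≤ 𝒢 0 := by
    rw [hS, Submodule.span_le]
    rintro _ ⟨x, hx, y, hy, rfl⟩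
    exact lie_mem_of_add_eq (by norm_num) hx hy
  have hmem {x y : 𝔤} (hx : x ∈ 𝒢 1) (hy : y ∈ 𝒢 (-1)) : ⁅x, y⁆ ∈ S :=
    Submodule.subset_span ⟨x, hx, y, hy, rfl⟩
  have hmem' {x y : 𝔤} (hx : x ∈ 𝒢 1) (hy : y ∈ 𝒢 (-1)) : ⁅y, x⁆ ∈ S := by
    rw [← lie_skew]
    exact S.neg_mem (hmem hx hy)
  have h1 : 𝒢 1 ≤ 𝒢 1 ⊔ 𝒢 (-1) ⊔ S := le_sup_left.trans le_sup_left
  have hm : 𝒢 (-1) ≤ 𝒢 1 ⊔ 𝒢 (-1) ⊔ S := le_sup_right.trans le_sup_left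
  have hs : S ≤ 𝒢 1 ⊔ 𝒢 (-1) ⊔ S := le_sup_right
  have hS' (a : 𝔤) (w : 𝔤) (hw : w ∈ S) : ⁅a, w⁆ ∈ 𝒢 1 ⊔ 𝒢 (-1) ⊔ S := by
    induction a using h.induction with
    | hm a ha => exact hm (lie_mem_of_add_eq (by norm_num) ha (hS0 hw))
    | hp a ha => exact h1 (lie_mem_of_add_eq (by norm_num) ha (hS0 hw))
    | hadd a b ha hb => rw [add_lie]; exact add_mem ha hb
    | hz a ha =>
      refine hs ?_
      have : S ≤ S.comap (LieAlgebra.ad ℂ 𝔤 a : 𝔤 →ₗ[ℂ] 𝔤) := by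
        conv_lhs => rw [hS]
        rw [Submodule.span_le]
        rintro _ ⟨x, hx, y, hy, rfl⟩
        change ⁅a, ⁅x, y⁆⁆ ∈ S
        rw [leibniz_lie]
        exact add_mem (hmem (lie_mem_of_add_eq (by norm_num) ha hx) hy)
          (hmem hx (lie_mem_of_add_eq (by norm_num) ha hy))
      exact this hw
  -- 𝔤₁ + 𝔤₋₁ + [𝔤₁, 𝔤₋₁] is an ideal. It contains 𝔤₁ ≠ 0, so it is all of 𝔤, and comparing degree-0
  -- components gives the claim.
  let I : LieIdeal ℂ 𝔤 :=
    { 𝒢 1 ⊔ 𝒢 (-1) ⊔ S with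
      lie_mem := by
        intro a m hm'
        change m ∈ 𝒢 1 ⊔ 𝒢 (-1) ⊔ S at hm'
        change ⁅a, m⁆ ∈ 𝒢 1 ⊔ 𝒢 (-1) ⊔ S
        obtain ⟨v, hv, w, hw, rfl⟩ := Submodule.mem_sup.1 hm'
        obtain ⟨x, hx, y, hy, rfl⟩ := Submodule.mem_sup.1 hv
        rw [lie_add, lie_add]
        refine add_mem (add_mem ?_ ?_) (hS' a w hw)
        · induction a using h.induction with
          | hm a ha => exact hs (hmem' hx ha)
          | hz a ha => exact h1 (lie_mem_of_add_eq (by norm_num) ha hx)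
          | hp a ha =>
            rw [h.lie_eq_zero (by norm_num) (by norm_num) (by norm_num) ha hx]
            exact zero_mem _
          | hadd a b ha hb => rw [add_lie]; exact add_mem ha hb
        · induction a using h.induction with
          | hp a ha => exact hs (hmem ha hy)
          | hz a ha => exact hm (lie_mem_of_add_eq (by norm_num) ha hy)
          | hm a ha =>
            rw [h.lie_eq_zero (by norm_num) (by norm_num) (by norm_num) ha hy]
            exact zero_mem _
          | hadd a b ha hb => rw [add_lie]; exact add_mem ha hb }
  have hI : I = ⊤ := by
    refine (LieAlgebra.IsSimple.eq_bot_or_eq_top I).resolve_left fun hbot => ?_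
    obtain ⟨x, hx, hx0⟩ := Submodule.exists_mem_ne_zero_of_ne_bot ((h 1).2 (by simp))
    have : x ∈ I := h1 hx
    rw [hbot, LieSubmodule.mem_bot] at this
    exact hx0 this
  have hzI : z ∈ 𝒢 1 ⊔ 𝒢 (-1) ⊔ S := by
    have : z ∈ I := hI ▸ LieSubmodule.mem_top z
    exact this
  obtain ⟨v, hv, w, hw, rfl⟩ := Submodule.mem_sup.1 hzI
  obtain ⟨x, hx, y, hy, rfl⟩ := Submodule.mem_sup.1 hv
  have e₁ : gradedProj 𝒢 0 (x + y + w) = gradedProj 𝒢 0 w := by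
    rw [map_add, map_add, gradedProj_of_ne (by norm_num) hx, gradedProj_of_ne (by norm_num) hy]
    simp
  have e₂ : x + y + w = w := by
    have := congrArg Subtype.val e₁
    rwa [gradedProj_of_mem hz, gradedProj_of_mem (hS0 hw)] at this
  rw [e₂]
  exact hw

/-- In a simple Lie algebra with a short grading, `𝔤₀` acts faithfully on `𝔤₁ ⊕ 𝔤₋₁`. -/
theorem IsShortGrading.eq_zero_of_lie_eq_zero [LieAlgebra.IsSimple ℂ 𝔤] (h : IsShortGrading 𝒢)
    {z : 𝔤} (hz : z ∈ 𝒢 0) (hp : ∀ x ∈ 𝒢 1, ⁅z, x⁆ = 0) (hm : ∀ x ∈ 𝒢 (-1), ⁅z, x⁆ = 0) :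
    z = 0 := by
  -- The kernel of the action is an ideal: brackets with 𝔤±₁ vanish by definition, and those with 𝔤₀
  -- stay inside by Jacobi. It lies in 𝔤₀, so it cannot contain 𝔤₁ ≠ 0.
  let I : LieIdeal ℂ 𝔤 :=
    { carrier := {z | z ∈ 𝒢 0 ∧ (∀ x ∈ 𝒢 1, ⁅z, x⁆ = 0) ∧ ∀ x ∈ 𝒢 (-1), ⁅z, x⁆ = 0}
      add_mem' := by
        rintro a b ⟨ha, ha₁, ha₂⟩ ⟨hb, hb₁, hb₂⟩
        exact ⟨add_mem ha hb, fun x hx => by rw [add_lie, ha₁ x hx, hb₁ x hx, add_zero],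
          fun x hx => by rw [add_lie, ha₂ x hx, hb₂ x hx, add_zero]⟩
      zero_mem' := ⟨zero_mem _, by simp, by simp⟩
      smul_mem' := by
        rintro c a ⟨ha, ha₁, ha₂⟩
        exact ⟨(𝒢 0).smul_mem c ha, fun x hx => by rw [smul_lie, ha₁ x hx, smul_zero],
          fun x hx => by rw [smul_lie, ha₂ x hx, smul_zero]⟩
      lie_mem := by
        rintro a m ⟨hm0, hm₁, hm₂⟩
        change ⁅a, m⁆ ∈ 𝒢 0 ∧ (∀ x ∈ 𝒢 1, ⁅⁅a, m⁆, x⁆ = 0) ∧ ∀ x ∈ 𝒢 (-1), ⁅⁅a, m⁆, x⁆ = 0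
        induction a using h.induction with
        | hm a ha =>
          rw [← lie_skew, hm₂ a ha]
          simp
        | hp a ha =>
          rw [← lie_skew, hm₁ a ha]
          simp
        | hz a ha =>
          refine ⟨lie_mem_of_add_eq (by norm_num) ha hm0, fun x hx => ?_, fun x hx => ?_⟩
          · rw [lie_lie, hm₁ x hx, hm₁ _ (lie_mem_of_add_eq (by norm_num) ha hx), lie_zero,
              sub_zero]
          · rw [lie_lie, hm₂ x hx, hm₂ _ (lie_mem_of_add_eq (by norm_num) ha hx), lie_zero,
              sub_zero]
        | hadd a b ha hb =>
          simp only [add_lie]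
          exact ⟨add_mem ha.1 hb.1, fun x hx => by rw [ha.2.1 x hx, hb.2.1 x hx, add_zero],
            fun x hx => by rw [ha.2.2 x hx, hb.2.2 x hx, add_zero]⟩ }
  rcases LieAlgebra.IsSimple.eq_bot_or_eq_top I with hI | hI
  · have : z ∈ I := ⟨hz, hp, hm⟩
    rwa [hI, LieSubmodule.mem_bot] at this
  · obtain ⟨x, hx, hx0⟩ := Submodule.exists_mem_ne_zero_of_ne_bot ((h 1).2 (by simp))
    have : x ∈ I := hI ▸ LieSubmodule.mem_top x
    exact absurd (DirectSum.degree_eq_of_mem_mem 𝒢 hx this.1 hx0) one_ne_zero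

/-! ### The Killing form of a short grading -/

variable (𝒢) in
/-- The action of `𝔤₀` on `𝔤ₖ`. -/
noncomputable def gradedAct (k : ℤ) : 𝒢 0 →ₗ[ℂ] Module.End ℂ (𝒢 k) where
  toFun z := (LieAlgebra.ad ℂ 𝔤 (z : 𝔤) : 𝔤 →ₗ[ℂ] 𝔤).restrict
    (fun _ hx => lie_mem_of_add_eq (zero_add k) z.2 hx)
  map_add' z w := LinearMap.ext fun x => Subtype.ext (add_lie (z : 𝔤) (w : 𝔤) (x : 𝔤))
  map_smul' c z := LinearMap.ext fun x => Subtype.ext (smul_lie c (z : 𝔤) (x : 𝔤))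

@[simp]
theorem gradedAct_coe (k : ℤ) (z : 𝒢 0) (x : 𝒢 k) : (gradedAct 𝒢 k z x : 𝔤) = ⁅(z : 𝔤), (x : 𝔤)⁆ :=
  rfl

theorem IsShortGrading.trace_eq [FiniteDimensional ℂ 𝔤] (h : IsShortGrading 𝒢)
    (f : Module.End ℂ 𝔤) (hf : ∀ k, Set.MapsTo f (𝒢 k) (𝒢 k)) :
    LinearMap.trace ℂ 𝔤 f = LinearMap.trace ℂ (𝒢 (-1)) (f.restrict (hf (-1))) +
      LinearMap.trace ℂ (𝒢 0) (f.restrict (hf 0)) +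
      LinearMap.trace ℂ (𝒢 1) (f.restrict (hf 1)) := by
  have hset : {i | 𝒢 i ≠ ⊥} = (({-1, 0, 1} : Finset ℤ) : Set ℤ) := by
    ext i
    simp [h i]
  have hfin : {i | 𝒢 i ≠ ⊥}.Finite := hset ▸ Finset.finite_toSet _
  rw [LinearMap.trace_eq_sum_trace_restrict' IsShortGrading.isInternal hfin hf,
    show hfin.toFinset = {-1, 0, 1} by
      apply Finset.coe_injective
      rw [Set.Finite.coe_toFinset, hset],
    Finset.sum_insert (by decide), Finset.sum_insert (by decide), Finset.sum_singleton, add_assoc]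

/-- ad x ∘ ad y shifts degrees by i + j, so it has no diagonal block. -/
theorem killingForm_eq_zero_of_add_ne_zero [FiniteDimensional ℂ 𝔤] {i j : ℤ} (hij : i + j ≠ 0)
    {x y : 𝔤} (hx : x ∈ 𝒢 i) (hy : y ∈ 𝒢 j) : killingForm ℂ 𝔤 x y = 0 := by
  change LinearMap.trace ℂ 𝔤 (LieAlgebra.ad ℂ 𝔤 x ∘ₗ LieAlgebra.ad ℂ 𝔤 y) = 0
  refine LinearMap.trace_eq_zero_of_mapsTo_ne (N := 𝒢) IsShortGrading.isInternal
    (fun k => i + (j + k)) (fun k hk => hij (by linarith)) fun k z hz => ?_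
  exact lie_mem_of_add_eq rfl hx (lie_mem_of_add_eq rfl hy hz)

theorem IsShortGrading.killingForm_zero_zero [FiniteDimensional ℂ 𝔤] (h : IsShortGrading 𝒢)
    (z w : 𝒢 0) : killingForm ℂ 𝔤 (z : 𝔤) (w : 𝔤) =
      LinearMap.trace ℂ (𝒢 (-1)) (gradedAct 𝒢 (-1) z * gradedAct 𝒢 (-1) w) +
      LinearMap.trace ℂ (𝒢 0) (gradedAct 𝒢 0 z * gradedAct 𝒢 0 w) +
      LinearMap.trace ℂ (𝒢 1) (gradedAct 𝒢 1 z * gradedAct 𝒢 1 w) :=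
  h.trace_eq (LieAlgebra.ad ℂ 𝔤 (z : 𝔤) ∘ₗ LieAlgebra.ad ℂ 𝔤 (w : 𝔤))
    fun _ _ hv => lie_mem_of_add_eq (zero_add _) z.2 (lie_mem_of_add_eq (zero_add _) w.2 hv)

/-- For `x ∈ 𝔤₁` and `y ∈ 𝔤₋₁`, the Killing form is `κ(x, y) = 2 B(x, y) + 2 B(y, x)`. -/
theorem IsShortGrading.killingForm_one_neg_one [FiniteDimensional ℂ 𝔤] (h : IsShortGrading 𝒢)
    (x : 𝒢 1) (y : 𝒢 (-1)) : killingForm ℂ 𝔤 (x : 𝔤) (y : 𝔤) =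
      2 * h.jordanPair.killingP x y + 2 * h.jordanPair.killingM y x := by
  have hf (k : ℤ) : Set.MapsTo (LieAlgebra.ad ℂ 𝔤 (x : 𝔤) ∘ₗ LieAlgebra.ad ℂ 𝔤 (y : 𝔤))
      (𝒢 k) (𝒢 k) :=
    fun v hv => lie_mem_of_add_eq (by ring) x.2 (lie_mem_of_add_eq rfl y.2 hv)
  -- On 𝔤₀ the map ad x ∘ ad y factors through 𝔤₋₁; cyclicity turns its trace into that of ad y ∘ ad
  -- x on 𝔤₋₁, which is 2{y, x, ·}.
  let X : 𝒢 (-1) →ₗ[ℂ] 𝒢 0 := (LieAlgebra.ad ℂ 𝔤 (x : 𝔤) : 𝔤 →ₗ[ℂ] 𝔤).restrict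
    fun v hv => lie_mem_of_add_eq (by norm_num) x.2 hv
  let Y : 𝒢 0 →ₗ[ℂ] 𝒢 (-1) := (LieAlgebra.ad ℂ 𝔤 (y : 𝔤) : 𝔤 →ₗ[ℂ] 𝔤).restrict
    fun v hv => lie_mem_of_add_eq (by norm_num) y.2 hv
  have e := h.trace_eq _ hf
  have e₁ : LinearMap.restrict _ (hf (-1)) = 0 := by
    ext v
    change ⁅(x : 𝔤), ⁅(y : 𝔤), (v : 𝔤)⁆⁆ = 0
    rw [h.lie_eq_zero (by norm_num) (by norm_num) (by norm_num) y.2 v.2, lie_zero]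
  have e₂ : LinearMap.restrict _ (hf 0) = X ∘ₗ Y := rfl
  have e₃ : LinearMap.restrict _ (hf 1) = (2 : ℂ) • h.jordanPair.triP x y := by
    ext v
    change ⁅(x : 𝔤), ⁅(y : 𝔤), (v : 𝔤)⁆⁆ = (2 : ℂ) • ((1 / 2 : ℂ) • ⁅⁅(x : 𝔤), (y : 𝔤)⁆, (v : 𝔤)⁆)
    rw [smul_smul, lie_lie, h.lie_eq_zero (by norm_num) (by norm_num) (by norm_num) x.2 v.2]
    simp
  have e₄ : Y ∘ₗ X = (2 : ℂ) • h.jordanPair.triM y x := by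
    ext v
    change ⁅(y : 𝔤), ⁅(x : 𝔤), (v : 𝔤)⁆⁆ = (2 : ℂ) • ((1 / 2 : ℂ) • ⁅⁅(y : 𝔤), (x : 𝔤)⁆, (v : 𝔤)⁆)
    rw [smul_smul, lie_lie, h.lie_eq_zero (by norm_num) (by norm_num) (by norm_num) y.2 v.2]
    simp
  rw [e₁, e₂, e₃, LinearMap.trace_comp_comm' Y X, e₄, map_zero, map_smul, map_smul, zero_add,
    add_comm] at e
  exact e

end Structure
/-- The sign in front of the trace of a product may be moved to the second factor. -/
theorem neg_trace_mul {V : Type*} [AddCommGroup V] [Module ℂ V] (f g : Module.End ℂ V) :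
    -LinearMap.trace ℂ V (f * g) = LinearMap.trace ℂ V (f * -g) := by
  rw [mul_neg, map_neg]

/-! ### The action of 𝔤₀ and the invariance of the trace forms -/

section ZeroPart

variable {𝔤 : Type*} [LieRing 𝔤] [LieAlgebra ℂ 𝔤] {𝒢 : ℤ → Submodule ℂ 𝔤} [GradedLieAlgebra 𝒢]

/-- The bracket `𝔤₁ × 𝔤₋₁ → 𝔤₀`. -/
def lieZero (x : 𝒢 1) (y : 𝒢 (-1)) : 𝒢 0 :=
  ⟨⁅(x : 𝔤), (y : 𝔤)⁆, lie_mem_of_add_eq (by norm_num) x.2 y.2⟩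

theorem IsShortGrading.gradedAct_one_lieZero (h : IsShortGrading 𝒢) (x : 𝒢 1) (y : 𝒢 (-1)) :
    gradedAct 𝒢 1 (lieZero x y) = (2 : ℂ) • h.jordanPair.triP x y := by
  ext u
  change ⁅⁅(x : 𝔤), (y : 𝔤)⁆, (u : 𝔤)⁆ = (2 : ℂ) • ((1 / 2 : ℂ) • ⁅⁅(x : 𝔤), (y : 𝔤)⁆, (u : 𝔤)⁆)
  rw [smul_smul]
  norm_num

theorem IsShortGrading.gradedAct_neg_one_lieZero (h : IsShortGrading 𝒢) (x : 𝒢 1)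
    (y : 𝒢 (-1)) : gradedAct 𝒢 (-1) (lieZero x y) = (-2 : ℂ) • h.jordanPair.triM y x := by
  ext u
  change ⁅⁅(x : 𝔤), (y : 𝔤)⁆, (u : 𝔤)⁆ = (-2 : ℂ) • ((1 / 2 : ℂ) • ⁅⁅(y : 𝔤), (x : 𝔤)⁆, (u : 𝔤)⁆)
  rw [smul_smul, ← lie_skew (x : 𝔤), neg_lie]
  norm_num

/-- The form in which 𝔤₀ = [𝔤₁, 𝔤₋₁] is used: a property stable under linear combinations need only
be checked on brackets. -/
theorem IsShortGrading.zero_induction [LieAlgebra.IsSimple ℂ 𝔤] (h : IsShortGrading 𝒢)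
    {motive : 𝒢 0 → Prop} (hlie : ∀ x y, motive (lieZero x y)) (hzero : motive 0)
    (hadd : ∀ z w, motive z → motive w → motive (z + w))
    (hsmul : ∀ (c : ℂ) z, motive z → motive (c • z)) (z : 𝒢 0) : motive z := by
  suffices H : ∀ w ∈ Submodule.span ℂ {w : 𝔤 | ∃ x ∈ 𝒢 1, ∃ y ∈ 𝒢 (-1), ⁅x, y⁆ = w},
      ∃ hw : w ∈ 𝒢 0, motive ⟨w, hw⟩ from (H z (h.mem_span_lie z.2)).2
  intro w hw
  induction hw using Submodule.span_induction with
  | mem w hw =>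
    obtain ⟨x, hx, y, hy, rfl⟩ := hw
    exact ⟨_, hlie ⟨x, hx⟩ ⟨y, hy⟩⟩
  | zero => exact ⟨zero_mem _, hzero⟩
  | add a b _ _ ha hb => exact ⟨add_mem ha.1 hb.1, hadd _ _ ha.2 hb.2⟩
  | smul c a _ ha => exact ⟨(𝒢 0).smul_mem c ha.1, hsmul c _ ha.2⟩

theorem IsShortGrading.gradedAct_injective [LieAlgebra.IsSimple ℂ 𝔤] (h : IsShortGrading 𝒢)
    {z w : 𝒢 0} (hp : gradedAct 𝒢 1 z = gradedAct 𝒢 1 w)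
    (hm : gradedAct 𝒢 (-1) z = gradedAct 𝒢 (-1) w) : z = w := by
  rw [← sub_eq_zero]
  rw [← sub_eq_zero, ← map_sub] at hp hm
  exact Subtype.ext (h.eq_zero_of_lie_eq_zero (z - w).2
    (fun x hx => congrArg Subtype.val (LinearMap.congr_fun hp ⟨x, hx⟩))
    (fun x hx => congrArg Subtype.val (LinearMap.congr_fun hm ⟨x, hx⟩)))

theorem gradedAct_gradedAct (k : ℤ) (z w : 𝒢 0) :
    gradedAct 𝒢 k (gradedAct 𝒢 0 z w) =
      gradedAct 𝒢 k z * gradedAct 𝒢 k w - gradedAct 𝒢 k w * gradedAct 𝒢 k z := by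
  ext x
  exact lie_lie (z : 𝔤) (w : 𝔤) (x : 𝔤)

/-- Cyclicity of the trace: Tr([U, Z]W) = -Tr(Z[U, W]). -/
theorem trace_gradedAct_invariant (k : ℤ) (u z w : 𝒢 0) :
    LinearMap.trace ℂ (𝒢 k) (gradedAct 𝒢 k (gradedAct 𝒢 0 u z) * gradedAct 𝒢 k w) =
      -LinearMap.trace ℂ (𝒢 k) (gradedAct 𝒢 k z * gradedAct 𝒢 k (gradedAct 𝒢 0 u w)) := by
  rw [gradedAct_gradedAct, gradedAct_gradedAct, sub_mul, mul_sub, map_sub, map_sub,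
    ← mul_assoc, ← mul_assoc, LinearMap.trace_mul_cycle ℂ (gradedAct 𝒢 k z) (gradedAct 𝒢 k w)]
  ring

/-- As z acts by derivations, {zu, v, ·} + {u, zv, ·} is the commutator of z with {u, v, ·}, which
has trace zero. -/
theorem IsShortGrading.killingP_gradedAct (h : IsShortGrading 𝒢) (z : 𝒢 0) (u : 𝒢 1)
    (v : 𝒢 (-1)) : h.jordanPair.killingP (gradedAct 𝒢 1 z u) v =
      -h.jordanPair.killingP u (gradedAct 𝒢 (-1) z v) := by
  have e : h.jordanPair.triP (gradedAct 𝒢 1 z u) v + h.jordanPair.triP u (gradedAct 𝒢 (-1) z v) =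
      gradedAct 𝒢 1 z * h.jordanPair.triP u v - h.jordanPair.triP u v * gradedAct 𝒢 1 z := by
    ext w
    change (1 / 2 : ℂ) • ⁅⁅⁅(z : 𝔤), (u : 𝔤)⁆, (v : 𝔤)⁆, (w : 𝔤)⁆ +
      (1 / 2 : ℂ) • ⁅⁅(u : 𝔤), ⁅(z : 𝔤), (v : 𝔤)⁆⁆, (w : 𝔤)⁆ =
      ⁅(z : 𝔤), (1 / 2 : ℂ) • ⁅⁅(u : 𝔤), (v : 𝔤)⁆, (w : 𝔤)⁆⁆ -
        (1 / 2 : ℂ) • ⁅⁅(u : 𝔤), (v : 𝔤)⁆, ⁅(z : 𝔤), (w : 𝔤)⁆⁆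
    rw [lie_smul, ← smul_add, ← smul_sub, ← add_lie, ← leibniz_lie,
      lie_lie (z : 𝔤) ⁅(u : 𝔤), (v : 𝔤)⁆]
  have t := congrArg (LinearMap.trace ℂ (𝒢 1)) e
  rw [map_add, map_sub, LinearMap.trace_mul_comm, sub_self] at t
  exact eq_neg_of_add_eq_zero_left t

theorem IsShortGrading.killingM_gradedAct (h : IsShortGrading 𝒢) (z : 𝒢 0) (u : 𝒢 (-1))
    (v : 𝒢 1) : h.jordanPair.killingM (gradedAct 𝒢 (-1) z u) v =
      -h.jordanPair.killingM u (gradedAct 𝒢 1 z v) := by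
  have e : h.jordanPair.triM (gradedAct 𝒢 (-1) z u) v + h.jordanPair.triM u (gradedAct 𝒢 1 z v) =
      gradedAct 𝒢 (-1) z * h.jordanPair.triM u v - h.jordanPair.triM u v * gradedAct 𝒢 (-1) z := by
    ext w
    change (1 / 2 : ℂ) • ⁅⁅⁅(z : 𝔤), (u : 𝔤)⁆, (v : 𝔤)⁆, (w : 𝔤)⁆ +
      (1 / 2 : ℂ) • ⁅⁅(u : 𝔤), ⁅(z : 𝔤), (v : 𝔤)⁆⁆, (w : 𝔤)⁆ =
      ⁅(z : 𝔤), (1 / 2 : ℂ) • ⁅⁅(u : 𝔤), (v : 𝔤)⁆, (w : 𝔤)⁆⁆ -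
        (1 / 2 : ℂ) • ⁅⁅(u : 𝔤), (v : 𝔤)⁆, ⁅(z : 𝔤), (w : 𝔤)⁆⁆
    rw [lie_smul, ← smul_add, ← smul_sub, ← add_lie, ← leibniz_lie,
      lie_lie (z : 𝔤) ⁅(u : 𝔤), (v : 𝔤)⁆]
  have t := congrArg (LinearMap.trace ℂ (𝒢 (-1))) e
  rw [map_add, map_sub, LinearMap.trace_mul_comm, sub_self] at t
  exact eq_neg_of_add_eq_zero_left t

end ZeroPart

/-! ### From Cartan involutions of the Jordan pair to Cartan involutions of the Lie algebra -/

namespace JordanPair.CartanInvolution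

variable {𝔤 : Type*} [LieRing 𝔤] [LieAlgebra ℂ 𝔤] {𝒢 : ℤ → Submodule ℂ 𝔤}
  [GradedLieAlgebra 𝒢] {h : IsShortGrading 𝒢}
  (ω : h.jordanPair.CartanInvolution)

/-- `w ∈ 𝔤₀` acts on `𝔤₁ ⊕ 𝔤₋₁` as the conjugate of `z ∈ 𝔤₀` by `ω`. -/
def Intertwines (z w : 𝒢 0) : Prop :=
  (∀ x, gradedAct 𝒢 (-1) w (ω.mapP x) = ω.mapP (gradedAct 𝒢 1 z x)) ∧
    ∀ y, gradedAct 𝒢 1 w (ω.mapM y) = ω.mapM (gradedAct 𝒢 (-1) z y)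

variable {ω}

theorem Intertwines.symm {z w : 𝒢 0} (hw : ω.Intertwines z w) : ω.Intertwines w z := by
  constructor
  · intro x
    rw [← ω.mapM_mapP x, hw.2, ω.mapP_mapM, ω.mapP_mapM]
  · intro y
    rw [← ω.mapP_mapM y, hw.1, ω.mapM_mapP, ω.mapM_mapP]

theorem Intertwines.add {z w z' w' : 𝒢 0} (hw : ω.Intertwines z w) (hw' : ω.Intertwines z' w') :
    ω.Intertwines (z + z') (w + w') :=
  ⟨fun x => by simp only [map_add, LinearMap.add_apply, hw.1, hw'.1],
    fun y => by simp only [map_add, LinearMap.add_apply, hw.2, hw'.2]⟩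

theorem Intertwines.smul {z w : 𝒢 0} (hw : ω.Intertwines z w) (c : ℂ) :
    ω.Intertwines (c • z) (starRingEnd ℂ c • w) :=
  ⟨fun x => by simp only [map_smul, LinearMap.smul_apply, LinearMap.map_smulₛₗ, hw.1],
    fun y => by simp only [map_smul, LinearMap.smul_apply, LinearMap.map_smulₛₗ, hw.2]⟩

theorem Intertwines.lie {z w z' w' : 𝒢 0} (hw : ω.Intertwines z w) (hw' : ω.Intertwines z' w') :
    ω.Intertwines (gradedAct 𝒢 0 z z') (gradedAct 𝒢 0 w w') :=
  ⟨fun x => by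
      simp only [gradedAct_gradedAct, LinearMap.sub_apply, Module.End.mul_apply, map_sub, hw.1,
        hw'.1],
    fun y => by
      simp only [gradedAct_gradedAct, LinearMap.sub_apply, Module.End.mul_apply, map_sub, hw.2,
        hw'.2]⟩

variable (ω)

/-- This is compatibility of ω with the triple products. The sign arises because [x, y] acts as 2{x,
y, ·} on 𝔤₁ but as -2{y, x, ·} on 𝔤₋₁, and ω exchanges the two. -/
theorem intertwines_lieZero (x : 𝒢 1) (y : 𝒢 (-1)) :
    ω.Intertwines (lieZero x y) (-lieZero (ω.mapM y) (ω.mapP x)) := by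
  constructor
  · intro u
    rw [map_neg, h.gradedAct_neg_one_lieZero, h.gradedAct_one_lieZero, LinearMap.neg_apply,
      LinearMap.smul_apply, LinearMap.smul_apply, ω.map_triP, LinearMap.map_smulₛₗ,
      map_ofNat, neg_smul, neg_neg]
  · intro u
    rw [map_neg, h.gradedAct_neg_one_lieZero, h.gradedAct_one_lieZero, LinearMap.neg_apply,
      LinearMap.smul_apply, LinearMap.smul_apply, ω.map_triM, LinearMap.map_smulₛₗ,
      map_neg, map_ofNat, neg_smul]

/-! ### The conjugation on 𝔤₀ and the extension of ω to 𝔤 -/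

variable [LieAlgebra.IsSimple ℂ 𝔤]

/-- Since ω is onto, both actions of `w` are prescribed, and 𝔤₀ acts faithfully. -/
theorem Intertwines.unique {ω : h.jordanPair.CartanInvolution} {z w w' : 𝒢 0}
    (hw : ω.Intertwines z w) (hw' : ω.Intertwines z w') :
    w = w' := by
  refine h.gradedAct_injective (LinearMap.ext fun x => ?_) (LinearMap.ext fun y => ?_)
  · rw [← ω.mapM_mapP x, hw.2, hw'.2]
  · rw [← ω.mapP_mapM y, hw.1, hw'.1]

theorem exists_intertwines (z : 𝒢 0) : ∃ w, ω.Intertwines z w := by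
  induction z using h.zero_induction with
  | hlie x y => exact ⟨_, ω.intertwines_lieZero x y⟩
  | hzero => exact ⟨0, fun x => by simp, fun y => by simp⟩
  | hadd z w hz hw =>
    obtain ⟨z', hz'⟩ := hz
    obtain ⟨w', hw'⟩ := hw
    exact ⟨_, hz'.add hw'⟩
  | hsmul c z hz =>
    obtain ⟨z', hz'⟩ := hz
    exact ⟨_, hz'.smul c⟩

/-- The conjugation that `ω` induces on `𝔤₀`. -/
noncomputable def zeroMap : 𝒢 0 →ₛₗ[starRingEnd ℂ] 𝒢 0 where
  toFun z := (ω.exists_intertwines z).choose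
  map_add' z w := (ω.exists_intertwines (z + w)).choose_spec.unique
    ((ω.exists_intertwines z).choose_spec.add (ω.exists_intertwines w).choose_spec)
  map_smul' c z := (ω.exists_intertwines (c • z)).choose_spec.unique
    ((ω.exists_intertwines z).choose_spec.smul c)

theorem intertwines_zeroMap (z : 𝒢 0) : ω.Intertwines z (ω.zeroMap z) :=
  (ω.exists_intertwines z).choose_spec

theorem zeroMap_zeroMap (z : 𝒢 0) : ω.zeroMap (ω.zeroMap z) = z :=
  (ω.intertwines_zeroMap _).unique (ω.intertwines_zeroMap z).symm

theorem zeroMap_gradedAct (z w : 𝒢 0) :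
    ω.zeroMap (gradedAct 𝒢 0 z w) = gradedAct 𝒢 0 (ω.zeroMap z) (ω.zeroMap w) :=
  (ω.intertwines_zeroMap _).unique ((ω.intertwines_zeroMap z).lie (ω.intertwines_zeroMap w))

theorem zeroMap_lieZero (x : 𝒢 1) (y : 𝒢 (-1)) :
    ω.zeroMap (lieZero x y) = -lieZero (ω.mapM y) (ω.mapP x) :=
  (ω.intertwines_zeroMap _).unique (ω.intertwines_lieZero x y)

/-- The antilinear map of `𝔤` equal to `-ω` on `𝔤₁ ⊕ 𝔤₋₁` and extending to `𝔤₀ = [𝔤₁, 𝔤₋₁]`. -/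
noncomputable def extend : 𝔤 →ₛₗ[starRingEnd ℂ] 𝔤 where
  toFun x := ω.zeroMap (gradedProj 𝒢 0 x) - ω.mapP (gradedProj 𝒢 1 x) -
    ω.mapM (gradedProj 𝒢 (-1) x)
  map_add' x y := by
    simp only [map_add, Submodule.coe_add]
    abel
  map_smul' c x := by
    simp only [map_smul, LinearMap.map_smulₛₗ, Submodule.coe_smul, smul_sub]

theorem extend_apply (x : 𝔤) : ω.extend x = ω.zeroMap (gradedProj 𝒢 0 x) -
    ω.mapP (gradedProj 𝒢 1 x) - ω.mapM (gradedProj 𝒢 (-1) x) := rfl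

@[simp]
theorem extend_one (x : 𝒢 1) : ω.extend x = -(ω.mapP x : 𝔤) := by
  rw [extend_apply, gradedProj_of_ne (k := 0) (by decide) x.2,
    gradedProj_of_ne (k := -1) (by decide) x.2, gradedProj_coe]
  simp

@[simp]
theorem extend_neg_one (x : 𝒢 (-1)) : ω.extend x = -(ω.mapM x : 𝔤) := by
  rw [extend_apply, gradedProj_of_ne (k := 0) (by decide) x.2,
    gradedProj_of_ne (k := 1) (by decide) x.2, gradedProj_coe]
  simp

@[simp]
theorem extend_zero (x : 𝒢 0) : ω.extend x = ω.zeroMap x := by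
  rw [extend_apply, gradedProj_of_ne (k := 1) (by decide) x.2,
    gradedProj_of_ne (k := -1) (by decide) x.2, gradedProj_coe]
  simp

theorem extend_extend (x : 𝔤) : ω.extend (ω.extend x) = x := by
  induction x using h.induction with
  | hm x hx => lift x to 𝒢 (-1) using hx; simp [ω.mapP_mapM]
  | hz x hx => lift x to 𝒢 0 using hx; simp [ω.zeroMap_zeroMap]
  | hp x hx => lift x to 𝒢 1 using hx; simp [ω.mapM_mapP]
  | hadd x y hx hy => rw [map_add, map_add, hx, hy]

theorem extend_lie_zero_one (z : 𝒢 0) (x : 𝒢 1) :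
    ω.extend ⁅(z : 𝔤), (x : 𝔤)⁆ = ⁅ω.extend z, ω.extend x⁆ := by
  rw [← gradedAct_coe, extend_one, ← (ω.intertwines_zeroMap z).1, gradedAct_coe, extend_zero,
    extend_one, lie_neg]

theorem extend_lie_zero_neg_one (z : 𝒢 0) (x : 𝒢 (-1)) :
    ω.extend ⁅(z : 𝔤), (x : 𝔤)⁆ = ⁅ω.extend z, ω.extend x⁆ := by
  rw [← gradedAct_coe, extend_neg_one, ← (ω.intertwines_zeroMap z).2, gradedAct_coe, extend_zero,
    extend_neg_one, lie_neg]

theorem extend_lie_zero_zero (z w : 𝒢 0) :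
    ω.extend ⁅(z : 𝔤), (w : 𝔤)⁆ = ⁅ω.extend z, ω.extend w⁆ := by
  rw [← gradedAct_coe, extend_zero, ω.zeroMap_gradedAct, gradedAct_coe, extend_zero, extend_zero]

theorem extend_lie_one_neg_one (x : 𝒢 1) (y : 𝒢 (-1)) :
    ω.extend ⁅(x : 𝔤), (y : 𝔤)⁆ = ⁅ω.extend x, ω.extend y⁆ := by
  rw [show ⁅(x : 𝔤), (y : 𝔤)⁆ = (lieZero x y : 𝔤) from rfl, extend_zero, zeroMap_lieZero,
    extend_one, extend_neg_one, neg_lie, lie_neg, neg_neg, Submodule.coe_neg]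
  exact lie_skew _ _

theorem extend_lie (x y : 𝔤) : ω.extend ⁅x, y⁆ = ⁅ω.extend x, ω.extend y⁆ := by
  -- By antisymmetry each mixed pair of degrees needs checking in one order only.
  have hskew {a b : 𝔤} (e : ω.extend ⁅b, a⁆ = ⁅ω.extend b, ω.extend a⁆) :
      ω.extend ⁅a, b⁆ = ⁅ω.extend a, ω.extend b⁆ := by
    rw [← lie_skew, map_neg, e, lie_skew]
  induction x using h.induction with
  | hadd x x' hx hx' => simp only [add_lie, map_add, hx, hx']
  | hz x hx =>
    lift x to 𝒢 0 using hx
    induction y using h.induction with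
    | hadd y y' hy hy' => simp only [lie_add, map_add, hy, hy']
    | hz y hy => exact ω.extend_lie_zero_zero x ⟨y, hy⟩
    | hp y hy => exact ω.extend_lie_zero_one x ⟨y, hy⟩
    | hm y hy => exact ω.extend_lie_zero_neg_one x ⟨y, hy⟩
  | hp x hx =>
    lift x to 𝒢 1 using hx
    induction y using h.induction with
    | hadd y y' hy hy' => simp only [lie_add, map_add, hy, hy']
    | hz y hy => exact hskew (ω.extend_lie_zero_one ⟨y, hy⟩ x)
    | hp y hy =>
      lift y to 𝒢 1 using hy
      rw [h.lie_eq_zero (by norm_num) (by norm_num) (by norm_num) x.2 y.2, extend_one, extend_one,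
        neg_lie, lie_neg, h.lie_eq_zero (by norm_num) (by norm_num) (by norm_num)
          (ω.mapP x).2 (ω.mapP y).2]
      simp
    | hm y hy => exact ω.extend_lie_one_neg_one x ⟨y, hy⟩
  | hm x hx =>
    lift x to 𝒢 (-1) using hx
    induction y using h.induction with
    | hadd y y' hy hy' => simp only [lie_add, map_add, hy, hy']
    | hz y hy => exact hskew (ω.extend_lie_zero_neg_one ⟨y, hy⟩ x)
    | hp y hy => exact hskew (ω.extend_lie_one_neg_one ⟨y, hy⟩ x)
    | hm y hy =>
      lift y to 𝒢 (-1) using hy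
      rw [h.lie_eq_zero (by norm_num) (by norm_num) (by norm_num) x.2 y.2, extend_neg_one,
        extend_neg_one, neg_lie, lie_neg, h.lie_eq_zero (by norm_num) (by norm_num) (by norm_num)
          (ω.mapM x).2 (ω.mapM y).2]
      simp

/-! ### Positivity of the extension -/

variable [FiniteDimensional ℂ 𝔤]

/-- Invariance of B and the intertwining relation make minus the action of `ω.zeroMap z` the adjoint
of the action of `z` for H(x, y) = B(x, ωy). -/
theorem neg_trace_one (z : 𝒢 0) :
    0 ≤ -LinearMap.trace ℂ (𝒢 1) (gradedAct 𝒢 1 z * gradedAct 𝒢 1 (ω.zeroMap z)) ∧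
      (gradedAct 𝒢 1 z ≠ 0 →
        0 < -LinearMap.trace ℂ (𝒢 1) (gradedAct 𝒢 1 z * gradedAct 𝒢 1 (ω.zeroMap z))) := by
  rw [neg_trace_mul]
  refine trace_mul_adjoint_nonneg_and_pos (LinearMap.mk₂'ₛₗ (RingHom.id ℂ) (starRingEnd ℂ)
    (fun x y => h.jordanPair.killingP x (ω.mapP y)) (by simp) (by simp) (by simp) (by simp))
    ω.posP _ _ fun x y => ?_
  change h.jordanPair.killingP (gradedAct 𝒢 1 z x) (ω.mapP y) =
    h.jordanPair.killingP x (ω.mapP (-gradedAct 𝒢 1 (ω.zeroMap z) y))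
  rw [h.killingP_gradedAct, map_neg, map_neg, (ω.intertwines_zeroMap z).symm.1]

theorem neg_trace_neg_one (z : 𝒢 0) :
    0 ≤ -LinearMap.trace ℂ (𝒢 (-1)) (gradedAct 𝒢 (-1) z * gradedAct 𝒢 (-1) (ω.zeroMap z)) ∧
      (gradedAct 𝒢 (-1) z ≠ 0 →
        0 < -LinearMap.trace ℂ (𝒢 (-1)) (gradedAct 𝒢 (-1) z * gradedAct 𝒢 (-1) (ω.zeroMap z))) := by
  rw [neg_trace_mul]
  refine trace_mul_adjoint_nonneg_and_pos (LinearMap.mk₂'ₛₗ (RingHom.id ℂ) (starRingEnd ℂ)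
    (fun x y => h.jordanPair.killingM x (ω.mapM y)) (by simp) (by simp) (by simp) (by simp))
    ω.posM _ _ fun x y => ?_
  change h.jordanPair.killingM (gradedAct 𝒢 (-1) z x) (ω.mapM y) =
    h.jordanPair.killingM x (ω.mapM (-gradedAct 𝒢 (-1) (ω.zeroMap z) y))
  rw [h.killingM_gradedAct, map_neg, map_neg, (ω.intertwines_zeroMap z).symm.2]

theorem neg_trace_add_pos {z : 𝒢 0} (hz : z ≠ 0) :
    0 < -LinearMap.trace ℂ (𝒢 1) (gradedAct 𝒢 1 z * gradedAct 𝒢 1 (ω.zeroMap z)) +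
      -LinearMap.trace ℂ (𝒢 (-1)) (gradedAct 𝒢 (-1) z * gradedAct 𝒢 (-1) (ω.zeroMap z)) := by
  by_cases hp : gradedAct 𝒢 1 z = 0
  · by_cases hm : gradedAct 𝒢 (-1) z = 0
    · exact absurd (h.gradedAct_injective (by rw [hp, map_zero]) (by rw [hm, map_zero])) hz
    · exact add_pos_of_nonneg_of_pos (ω.neg_trace_one z).1 ((ω.neg_trace_neg_one z).2 hm)
  · exact add_pos_of_pos_of_nonneg ((ω.neg_trace_one z).2 hp) (ω.neg_trace_neg_one z).1

/-- The adjoint argument is repeated on 𝔤₀ itself, with the positive definite form of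
`neg_trace_add_pos`. Only nonnegativity can hold, since central elements of 𝔤₀ act on it by zero. -/
theorem neg_trace_zero (z : 𝒢 0) :
    0 ≤ -LinearMap.trace ℂ (𝒢 0) (gradedAct 𝒢 0 z * gradedAct 𝒢 0 (ω.zeroMap z)) := by
  rw [neg_trace_mul]
  refine (trace_mul_adjoint_nonneg_and_pos (LinearMap.mk₂'ₛₗ (RingHom.id ℂ) (starRingEnd ℂ)
    (fun z w => -LinearMap.trace ℂ (𝒢 1) (gradedAct 𝒢 1 z * gradedAct 𝒢 1 (ω.zeroMap w)) +
      -LinearMap.trace ℂ (𝒢 (-1)) (gradedAct 𝒢 (-1) z * gradedAct 𝒢 (-1) (ω.zeroMap w)))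
    (fun _ _ _ => by simp only [map_add, add_mul]; ring)
    (fun _ _ _ => by simp [mul_add])
    (fun _ _ _ => by simp only [map_add, mul_add]; ring)
    (fun _ _ _ => by simp [mul_add]))
    (fun _ => ω.neg_trace_add_pos) _ _ fun x y => ?_).1
  simp only [LinearMap.mk₂'ₛₗ_apply, LinearMap.neg_apply, map_neg, trace_gradedAct_invariant,
    zeroMap_gradedAct, zeroMap_zeroMap]
  ring

theorem neg_killingForm_zero {z : 𝒢 0} (hz : z ≠ 0) :
    0 < -killingForm ℂ 𝔤 (z : 𝔤) (ω.extend z) := by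
  rw [extend_zero, h.killingForm_zero_zero]
  convert! add_pos_of_pos_of_nonneg (ω.neg_trace_add_pos hz) (ω.neg_trace_zero z) using 1
  ring

theorem neg_killingForm_one {x : 𝒢 1} (hx : x ≠ 0) :
    0 < -killingForm ℂ 𝔤 (x : 𝔤) (ω.extend x) := by
  rw [extend_one, map_neg, neg_neg, h.killingForm_one_neg_one]
  have hx' : ω.mapP x ≠ 0 := fun e => hx (by rw [← ω.mapM_mapP x, e, map_zero])
  have h₁ := ω.posP x hx
  -- With y = ωx, the second term B(ωx, x) of the Killing form is H(y).
  have h₂ := ω.posM _ hx'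
  rw [ω.mapM_mapP] at h₂
  positivity

theorem neg_killingForm_neg_one {x : 𝒢 (-1)} (hx : x ≠ 0) :
    0 < -killingForm ℂ 𝔤 (x : 𝔤) (ω.extend x) := by
  rw [LieModule.traceForm_comm, extend_neg_one, map_neg, LinearMap.neg_apply, neg_neg,
    h.killingForm_one_neg_one]
  have hx' : ω.mapM x ≠ 0 := fun e => hx (by rw [← ω.mapP_mapM x, e, map_zero])
  have h₁ := ω.posM x hx
  have h₂ := ω.posP _ hx'
  rw [ω.mapP_mapM] at h₂
  positivity

theorem neg_killingForm_extend_pos (x : 𝔤) (hx : x ≠ 0) : 0 < -killingForm ℂ 𝔤 x (ω.extend x) := by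
  -- The extension reverses degrees and κ pairs only opposite degrees, so the cross terms vanish.
  have hsplit : -killingForm ℂ 𝔤 x (ω.extend x) =
      -killingForm ℂ 𝔤 (gradedProj 𝒢 (-1) x : 𝔤) (ω.extend (gradedProj 𝒢 (-1) x)) +
      -killingForm ℂ 𝔤 (gradedProj 𝒢 0 x : 𝔤) (ω.extend (gradedProj 𝒢 0 x)) +
      -killingForm ℂ 𝔤 (gradedProj 𝒢 1 x : 𝔤) (ω.extend (gradedProj 𝒢 1 x)) := by
    conv_lhs => rw [h.eq_add x]
    have k {i j : ℤ} (hij : i + j ≠ 0) (a : 𝒢 i) (b : 𝒢 j) : killingForm ℂ 𝔤 (a : 𝔤) b = 0 :=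
      killingForm_eq_zero_of_add_ne_zero hij a.2 b.2
    simp only [map_add, LinearMap.add_apply, extend_one, extend_zero, extend_neg_one, map_neg]
    rw [k (i := -1) (j := 0) (by decide), k (i := -1) (j := -1) (by decide),
      k (i := 0) (j := 1) (by decide), k (i := 0) (j := -1) (by decide),
      k (i := 1) (j := 0) (by decide), k (i := 1) (j := 1) (by decide)]
    ring
  have hm : 0 ≤ -killingForm ℂ 𝔤 (gradedProj 𝒢 (-1) x : 𝔤) (ω.extend (gradedProj 𝒢 (-1) x)) := by
    by_cases h0 : gradedProj 𝒢 (-1) x = 0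
    · simp [h0]
    · exact (ω.neg_killingForm_neg_one h0).le
  have hz : 0 ≤ -killingForm ℂ 𝔤 (gradedProj 𝒢 0 x : 𝔤) (ω.extend (gradedProj 𝒢 0 x)) := by
    by_cases h0 : gradedProj 𝒢 0 x = 0
    · simp [h0]
    · exact (ω.neg_killingForm_zero h0).le
  have hp : 0 ≤ -killingForm ℂ 𝔤 (gradedProj 𝒢 1 x : 𝔤) (ω.extend (gradedProj 𝒢 1 x)) := by
    by_cases h0 : gradedProj 𝒢 1 x = 0
    · simp [h0]
    · exact (ω.neg_killingForm_one h0).le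
  rw [hsplit]
  by_cases h₁ : gradedProj 𝒢 1 x = 0
  · by_cases h₀ : gradedProj 𝒢 0 x = 0
    · have h₂ : gradedProj 𝒢 (-1) x ≠ 0 := fun h₂ => hx (by rw [h.eq_add x, h₀, h₁, h₂]; simp)
      exact add_pos_of_pos_of_nonneg
        (add_pos_of_pos_of_nonneg (ω.neg_killingForm_neg_one h₂) hz) hp
    · exact add_pos_of_pos_of_nonneg
        (add_pos_of_nonneg_of_pos hm (ω.neg_killingForm_zero h₀)) hp
  · exact add_pos_of_nonneg_of_pos (add_nonneg hm hz) (ω.neg_killingForm_one h₁)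

/-- The Cartan involution of `𝔤` that induces `ω`. -/
noncomputable def toLie : LieCartanInvolution 𝔤 where
  toMap := ω.extend
  invol := ω.extend_extend
  map_bracket := ω.extend_lie
  pos := ω.neg_killingForm_extend_pos

theorem toLie_reversesGrading : ω.toLie.ReversesGrading 𝒢 := by
  have key (k : ℤ) (x : 𝔤) (hx : x ∈ 𝒢 k) : ω.extend x ∈ 𝒢 (-k) := by
    by_cases h0 : x = 0
    · rw [h0, map_zero]
      exact zero_mem _
    · rcases h.cases_of_ne_zero hx h0 with rfl | rfl | rfl
      · rw [show x = ((⟨x, hx⟩ : 𝒢 (-1)) : 𝔤) from rfl, extend_neg_one, neg_neg]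
        exact neg_mem (ω.mapM _).2
      · rw [show x = ((⟨x, hx⟩ : 𝒢 0) : 𝔤) from rfl, extend_zero, neg_zero]
        exact (ω.zeroMap _).2
      · rw [show x = ((⟨x, hx⟩ : 𝒢 1) : 𝔤) from rfl, extend_one]
        exact neg_mem (ω.mapP _).2
  intro k
  apply le_antisymm
  · rintro _ ⟨x, hx, rfl⟩
    exact key k x hx
  · intro x hx
    refine ⟨ω.extend x, ?_, ω.extend_extend x⟩
    have := key (-k) x hx
    rwa [neg_neg] at this

end JordanPair.CartanInvolution

/-! ### From Cartan involutions of the Lie algebra to Cartan involutions of the Jordan pair -/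

namespace LieCartanInvolution

variable {𝔤 : Type*} [LieRing 𝔤] [LieAlgebra ℂ 𝔤] {𝒢 : ℤ → Submodule ℂ 𝔤}

theorem ReversesGrading.map_mem {θ : LieCartanInvolution 𝔤} (hθ : θ.ReversesGrading 𝒢) {i j : ℤ}
    (hij : i + j = 0) {x : 𝔤} (hx : x ∈ 𝒢 i) : θ.toMap x ∈ 𝒢 j := by
  have : θ.toMap x ∈ (𝒢 i).map θ.toMap := ⟨x, hx, rfl⟩
  rw [hθ i] at this
  rwa [show j = -i by linarith]

/-- The restriction of `-θ` to a map `𝔤ᵢ → 𝔤ⱼ`, where `i + j = 0`. -/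
def negRestrict (θ : LieCartanInvolution 𝔤) (hθ : θ.ReversesGrading 𝒢) (i j : ℤ)
    (hij : i + j = 0) : 𝒢 i →ₛₗ[starRingEnd ℂ] 𝒢 j where
  toFun x := ⟨-θ.toMap x, neg_mem (hθ.map_mem hij x.2)⟩
  map_add' x y := Subtype.ext (by simp [add_comm])
  map_smul' c x := Subtype.ext (by simp)

variable {θ : LieCartanInvolution 𝔤} (hθ : θ.ReversesGrading 𝒢)

@[simp]
theorem negRestrict_coe {i j : ℤ} (hij : i + j = 0) (x : 𝒢 i) :
    (θ.negRestrict hθ i j hij x : 𝔤) = -θ.toMap x := rfl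

theorem negRestrict_negRestrict {i j : ℤ} (hij : i + j = 0) (hji : j + i = 0) (x : 𝒢 i) :
    θ.negRestrict hθ j i hji (θ.negRestrict hθ i j hij x) = x := by
  ext
  simp [θ.invol]

theorem negRestrict_gradedTriple [GradedLieAlgebra 𝒢] {i j : ℤ} (hij : i + j = 0)
    (hji : j + i = 0) (x : 𝒢 i) (y : 𝒢 j) (z : 𝒢 i) :
    gradedTriple 𝒢 j i hji (θ.negRestrict hθ i j hij x) (θ.negRestrict hθ j i hji y)
      (θ.negRestrict hθ i j hij z) = θ.negRestrict hθ i j hij (gradedTriple 𝒢 i j hij x y z) := by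
  ext
  have hc : starRingEnd ℂ (1 / 2) = 1 / 2 := by
    rw [map_div₀, map_one, map_ofNat]
  simp only [gradedTriple_coe, negRestrict_coe, LinearMap.map_smulₛₗ, θ.map_bracket, hc, neg_lie,
    lie_neg, neg_neg, smul_neg]

variable [GradedLieAlgebra 𝒢] [FiniteDimensional ℂ 𝔤]

/-- By invariance of κ, {x, y, ·} on 𝔤₁ and {y, x, ·} on 𝔤₋₁ are transposes for κ, and positivity of
θ makes κ nondegenerate between 𝔤₁ and 𝔤₋₁. -/
theorem ReversesGrading.killingP_eq_killingM {θ : LieCartanInvolution 𝔤}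
    (hθ : θ.ReversesGrading 𝒢) (h : IsShortGrading 𝒢) (x : 𝒢 1) (y : 𝒢 (-1)) :
    h.jordanPair.killingP x y = h.jordanPair.killingM y x := by
  refine trace_eq_of_adjoint ((killingForm ℂ 𝔤).compl₁₂ (𝒢 1).subtype (𝒢 (-1)).subtype)
    (fun u hu => ⟨θ.negRestrict hθ 1 (-1) (by norm_num) u, ?_⟩)
    (fun v hv => ⟨θ.negRestrict hθ (-1) 1 (by norm_num) v, ?_⟩) _ _ fun u v => ?_
  · have := θ.pos u (by simpa using hu)
    rw [← map_neg] at this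
    exact this.ne'
  · have := θ.pos v (by simpa using hv)
    rw [LieModule.traceForm_comm, ← LinearMap.neg_apply, ← map_neg] at this
    exact this.ne'
  · change killingForm ℂ 𝔤 ((1 / 2 : ℂ) • ⁅⁅(x : 𝔤), (y : 𝔤)⁆, (u : 𝔤)⁆) (v : 𝔤) =
      killingForm ℂ 𝔤 (u : 𝔤) ((1 / 2 : ℂ) • ⁅⁅(y : 𝔤), (x : 𝔤)⁆, (v : 𝔤)⁆)
    rw [map_smul, map_smul, LinearMap.smul_apply, ← lie_skew _ (u : 𝔤), map_neg,
      LinearMap.neg_apply, LieModule.traceForm_apply_lie_apply, ← lie_skew (y : 𝔤) (x : 𝔤), neg_lie,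
      map_neg]

/-- The Cartan involution of the Jordan pair induced by a grading-reversing Cartan involution. -/
def toJordan (θ : LieCartanInvolution 𝔤) (hθ : θ.ReversesGrading 𝒢) (h : IsShortGrading 𝒢) :
    h.jordanPair.CartanInvolution where
  mapP := θ.negRestrict hθ 1 (-1) (by norm_num)
  mapM := θ.negRestrict hθ (-1) 1 (by norm_num)
  mapM_mapP := negRestrict_negRestrict hθ _ _
  mapP_mapM := negRestrict_negRestrict hθ _ _
  map_triP := negRestrict_gradedTriple hθ _ _
  map_triM := negRestrict_gradedTriple hθ _ _
  posP x hx := by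
    have e := h.killingForm_one_neg_one x (θ.negRestrict hθ 1 (-1) (by norm_num) x)
    have p := θ.pos x (by simpa using hx)
    rw [← hθ.killingP_eq_killingM, negRestrict_coe, map_neg] at e
    -- Now -κ(x, θx) = 4B(x, ωx).
    rw [e, ← two_mul, ← mul_assoc] at p
    exact (mul_pos_iff_of_pos_left (by norm_num)).1 p
  posM x hx := by
    have e := h.killingForm_one_neg_one (θ.negRestrict hθ (-1) 1 (by norm_num) x) x
    have p := θ.pos x (by simpa using hx)
    rw [hθ.killingP_eq_killingM, negRestrict_coe, LieModule.traceForm_comm, map_neg] at e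
    rw [e, ← two_mul, ← mul_assoc] at p
    exact (mul_pos_iff_of_pos_left (by norm_num)).1 p

end LieCartanInvolution

/-! ### The bijection -/

theorem proposition3p2 {𝔤 : Type*} [LieRing 𝔤] [LieAlgebra ℂ 𝔤] [FiniteDimensional ℂ 𝔤]
    [LieAlgebra.IsSimple ℂ 𝔤] (𝒢 : ℤ → Submodule ℂ 𝔤) [GradedLieAlgebra 𝒢]
    (h𝒢 : IsShortGrading 𝒢) :
    ∃ Φ : {θ : LieCartanInvolution 𝔤 // θ.ReversesGrading 𝒢} → h𝒢.jordanPair.CartanInvolution,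
      (∀ θ, (∀ x : 𝒢 1, ((Φ θ).mapP x : 𝔤) = gradingAut 𝒢 (θ.1.toMap x)) ∧
        (∀ x : 𝒢 (-1), ((Φ θ).mapM x : 𝔤) = gradingAut 𝒢 (θ.1.toMap x))) ∧
      Function.Bijective Φ := by
  refine ⟨fun θ => θ.1.toJordan θ.2 h𝒢, fun θ => ⟨fun x => ?_, fun x => ?_⟩, ?_, ?_⟩
  · exact (gradingAut_neg_one 𝒢 (θ.2.map_mem (by norm_num) x.2)).symm
  · exact (gradingAut_one 𝒢 (θ.2.map_mem (by norm_num) x.2)).symm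
  · rintro ⟨θ, hθ⟩ ⟨θ', hθ'⟩ e
    have hp : ∀ x ∈ 𝒢 1, θ.toMap x = θ'.toMap x := fun x hx =>
      neg_injective (congrArg (fun ω => ((ω.mapP ⟨x, hx⟩ : 𝒢 (-1)) : 𝔤)) e)
    have hm : ∀ x ∈ 𝒢 (-1), θ.toMap x = θ'.toMap x := fun x hx =>
      neg_injective (congrArg (fun ω => ((ω.mapM ⟨x, hx⟩ : 𝒢 1) : 𝔤)) e)
    -- Agreement on 𝔤±₁ propagates to 𝔤₀ through brackets.
    have hz : ∀ z : 𝒢 0, θ.toMap z = θ'.toMap z := fun z => by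
      induction z using h𝒢.zero_induction with
      | hlie x y =>
        change θ.toMap ⁅(x : 𝔤), (y : 𝔤)⁆ = θ'.toMap ⁅(x : 𝔤), (y : 𝔤)⁆
        rw [θ.map_bracket, θ'.map_bracket, hp x x.2, hm y y.2]
      | hzero => simp
      | hadd z w hz hw => rw [Submodule.coe_add, map_add, map_add, hz, hw]
      | hsmul c z hz => rw [Submodule.coe_smul, LinearMap.map_smulₛₗ, LinearMap.map_smulₛₗ, hz]
    refine Subtype.ext (LieCartanInvolution.ext (LinearMap.ext fun x => ?_))
    induction x using h𝒢.induction with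
    | hm x hx => exact hm x hx
    | hz x hx => exact hz ⟨x, hx⟩
    | hp x hx => exact hp x hx
    | hadd x y hx hy => rw [map_add, map_add, hx, hy]
  · intro ω
    refine ⟨⟨ω.toLie, ω.toLie_reversesGrading⟩, JordanPair.CartanInvolution.ext ?_ ?_⟩
    · ext x
      change -ω.extend x = _
      rw [ω.extend_one, neg_neg]
    · ext x
      change -ω.extend x = _
      rw [ω.extend_neg_one, neg_neg]
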